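/- Fix $L\ge 2$, $P\ge 0$ and $P_0\ge 0$. Consider the additive white Gaussian noise multiway relay channel with users $1,\dots,L$ and relay $0$. At each time $t$, the relay receives $Y_0[t]=\sum_{i=1}^{L}X_i[t]+N_0[t]$ and user $i$ receives $Y_i[t]=X_0[t]+N_i[t]$, where $X_j[t]$ is the channel input of node $j$ and the noises $N_j[t]$, over all nodes $j\in\{0,\dots,L\}$ and all times $t$, are independent standard Gaussian random variables. For message numbers $M_1,\dots,M_L\ge 1$, a block code of $n$ channel uses (unrestricted, i.e. with feedback) consists of measurable encoding functions, with $X_0[t]=f_{0,t}(Y_0[1],\dots,Y_0[t-1])$ at the relay and $X_i[t]=f_{i,t}(W_i,Y_i[1],\dots,Y_i[t-1])$ at user $i$, and of measurable decoding functions, by which user $i$ forms estimates $(\hat W_{i,j})_{j\ne i}=g_i(Y_i[1],\dots,Y_i[n],W_i)$ of the messages of all other users. The messages $W_i$ are uniform on $\{1,\dots,M_i\}$, independent of each other and of the noise. The code must satisfy the average power constraints $\frac1n\sum_{t=1}^{n}E[X_i[t]^2]\le P$ for every user $i$ and $\frac1n\sum_{t=1}^{n}E[X_0[t]^2]\le P_0$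 for the relay. Its error probability is $P_{\mathrm e}=\Pr\{\hat W_{i,j}\ne W_j\text{ for some users } i\ne j\}$. An equal rate $R\ge 0$ (in bits per channel use) is achievable if for every $\epsilon>0$ and all sufficiently large $n$ there is such a code with $M_i=\lfloor 2^{nR}\rfloor$ for all $i$ and $P_{\mathrm e}<\epsilon$. The equal-rate capacity $C$ is the supremum of all achievable equal rates. Then $$C\;\le\;\min\left\{\min_{\ell\in\{1,\dots,L-1\}}\frac{1}{2\ell}\log_2\left(1+\ell^2P\right),\ \frac{1}{2(L-1)}\log_2\left(1+P_0\right)\right\}.$$ -/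

import Mathlib

open scoped NNReal ENNReal

/-- The parameters of an AWGN multiway relay channel with `L` users. The nodes are indexed by
`Fin (L + 1)`: node `0` is the relay and node `i.succ` is user `i : Fin L`. -/
structure MWRC (L : ℕ) where
  /-- `power j` is the average transmitted power allowed at node `j`. -/
  power : Fin (L + 1) → ℝ
  /-- `noiseVar j` is the variance of the receiver noise at node `j`. -/
  noiseVar : Fin (L + 1) → ℝ≥0

namespace MWRC

/-- The symmetrical channel: power `P₀` at the relay, power `P` at each user, and unit noise
variance at every node. -/
def symmetric (L : ℕ) (P P₀ : ℝ) : MWRC L where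
  power := Fin.cons P₀ (fun _ => P)
  noiseVar := fun _ => 1

/-- The outputs of one channel use with inputs `x` and noise `z`: the relay receives the sum of
all users' inputs plus its noise, each user receives the relay's input plus its own noise. -/
def output {L : ℕ} (x z : Fin (L + 1) → ℝ) : Fin (L + 1) → ℝ :=
  Fin.cons (∑ i : Fin L, x i.succ + z 0) (fun i => x 0 + z i.succ)

/-- A block code of `n` channel uses, in which user `i` has `M i` messages. At time `t` every
node may use its channel outputs of the times before `t`; each user moreover uses its own
message. User `i` decodes the messages of all other users from all its channel outputs and its
own message. -/
structure BlockCode (L n : ℕ) (M : Fin L → ℕ) where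
  relayEnc : (t : Fin n) → (Fin t → ℝ) → ℝ
  userEnc : (i : Fin L) → (t : Fin n) → Fin (M i) → (Fin t → ℝ) → ℝ
  dec : (i : Fin L) → (Fin n → ℝ) → Fin (M i) → (j : {j : Fin L // j ≠ i}) → Fin (M j)
  measurable_relayEnc : ∀ t, Measurable (relayEnc t)
  measurable_userEnc : ∀ i t m, Measurable (userEnc i t m)
  measurable_dec : ∀ i m, Measurable (fun y => dec i y m)

namespace BlockCode

variable {L n : ℕ} {M : Fin L → ℕ}

/-- The inputs of all nodes at time `t`, for messages `w`, when the channel outputs before time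
`t` were `y`. -/
def input (c : BlockCode L n M) (w : ∀ i, Fin (M i)) (t : Fin n)
    (y : Fin t → Fin (L + 1) → ℝ) : Fin (L + 1) → ℝ :=
  Fin.cons (c.relayEnc t (fun s => y s 0))
    (fun i => c.userEnc i t (w i) (fun s => y s i.succ))

/-- The outputs at all nodes in the first `t` channel uses, for messages `w` and noise `z`
(where `z s j` is the noise at node `j` at time `s`). -/
def history (c : BlockCode L n M) (w : ∀ i, Fin (M i)) (z : Fin n → Fin (L + 1) → ℝ) :
    (t : ℕ) → t ≤ n → Fin t → Fin (L + 1) → ℝ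
  | 0, _ => fun s => s.elim0
  | t + 1, h =>
      let y := history c w z t (Nat.le_of_succ_le h)
      Fin.snoc (α := fun _ => Fin (L + 1) → ℝ) y (output (c.input w ⟨t, h⟩ y) (z ⟨t, h⟩))

/-- `c.received w z t j` is the channel output at node `j` at time `t`. -/
def received (c : BlockCode L n M) (w : ∀ i, Fin (M i)) (z : Fin n → Fin (L + 1) → ℝ) :
    Fin n → Fin (L + 1) → ℝ :=
  c.history w z n le_rfl

/-- `c.transmitted w z t j` is the channel input of node `j` at time `t`. -/
def transmitted (c : BlockCode L n M) (w : ∀ i, Fin (M i)) (z : Fin n → Fin (L + 1) → ℝ)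
    (t : Fin n) : Fin (L + 1) → ℝ :=
  c.input w t (c.history w z t t.isLt.le)

end BlockCode

/-- The joint law of the messages and the noise: the messages are uniform, the noise at node `j`
is centred Gaussian with variance `noiseVar j`, and everything is independent, over users, nodes
and time. -/
noncomputable def law {L : ℕ} (ch : MWRC L) (n : ℕ) (M : Fin L → ℕ) :
    MeasureTheory.Measure ((∀ i, Fin (M i)) × (Fin n → Fin (L + 1) → ℝ)) :=
  (MeasureTheory.Measure.pi
    (fun i => ProbabilityTheory.uniformOn (Set.univ : Set (Fin (M i))))).prod
  (MeasureTheory.Measure.pi (fun _ : Fin n =>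
    MeasureTheory.Measure.pi (fun j => ProbabilityTheory.gaussianReal 0 (ch.noiseVar j))))

namespace BlockCode

variable {L n : ℕ} {M : Fin L → ℕ}

/-- The average power constraint `(∑ t, E[X_j[t]²]) / n ≤ P_j` at every node `j`. -/
def SatisfiesPower (c : BlockCode L n M) (ch : MWRC L) : Prop :=
  ∀ j, (∑ t, ∫⁻ ω, ENNReal.ofReal ((c.transmitted ω.1 ω.2 t j) ^ 2) ∂(ch.law n M)) / n
    ≤ ENNReal.ofReal (ch.power j)

/-- The event that some user decodes the message of some other user wrongly. -/
def errorEvent (c : BlockCode L n M) : Set ((∀ i, Fin (M i)) × (Fin n → Fin (L + 1) → ℝ)) :=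
  {ω | ∃ (i : Fin L) (j : {j : Fin L // j ≠ i}),
    c.dec i (fun t => c.received ω.1 ω.2 t i.succ) (ω.1 i) j ≠ ω.1 j}

/-- The average probability of error. -/
noncomputable def errorProb (c : BlockCode L n M) (ch : MWRC L) : ℝ≥0∞ :=
  ch.law n M c.errorEvent

end BlockCode

/-- Achievability of a rate tuple, in bits per channel use: for every `ε > 0` there is, for all
sufficiently large `n`, a block code of `n` channel uses that meets the power constraints and has
error probability below `ε`, where user `i` has the messages `1, 2, …, ⌊2 ^ (n R_i)⌋`. -/
def IsAchievable {L : ℕ} (ch : MWRC L) (R : Fin L → ℝ) : Prop :=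
  (∀ i, 0 ≤ R i) ∧ ∀ ε : ℝ, 0 < ε → ∀ᶠ n : ℕ in Filter.atTop,
    ∃ c : BlockCode L n (fun i => ⌊(2 : ℝ) ^ ((n : ℝ) * R i)⌋₊),
      c.SatisfiesPower ch ∧ c.errorProb ch < ENNReal.ofReal ε

/-- The equal-rate capacity: the supremum, taken in the extended reals, of all `R` such that the
rate tuple `(R, R, …, R)` is achievable. -/
noncomputable def equalRateCapacity {L : ℕ} (ch : MWRC L) : EReal :=
  sSup ((fun R : ℝ => (R : EReal)) '' {R : ℝ | ch.IsAchievable (fun _ => R)})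

end MWRC

/-!
The bound is a cut-set bound, proved by a change of measure instead of mutual information, so that
feedback needs no chain rule for differential entropies.

Fix a set `S` of nodes and a user `i` outside `S`. Silence `S`: let its nodes transmit `0`, and add
to the noise at each node outside `S` the signal that `S` would have caused there. Outside `S`
nothing changes (`MWRC.BlockCode.history_silence`), so the code is now driven by the messages
outside `S` and by the shifted noise alone. If the shifted noise were white Gaussian and
independent of the messages, user `i` could only guess the messages of `S`
(`measure_correctEvent_silence_le`). The true law is compared with this one, the shifted noise
having variance `1 + σ j` at node `j`. The shift at time `t` depends only on the messages and the
earlier noise, so it preserves Lebesgue measure, and the likelihood ratio is an explicit quotient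
of Gaussian densities (`lintegral_exp_neg_infoDensity`). The mean of its logarithm is at most
`n * ∑ j, log (1 + σ j) / 2` as soon as the signal of `S` has average power at most `σ j` at node
`j` (`integral_cutDensity_le`), since noise and signal are uncorrelated. The Donsker-Varadhan
inequality (`measureReal_mul_log_le`) turns this into a converse with one extra bit,
`cutset_bound`.

For `ℓ` users against the rest, the signal reaches only the relay and has power at most `ℓ ^ 2 * P`
by Cauchy-Schwarz; for all nodes but user `i` it is the input of the relay, of power at most `P₀`.
Dividing by `n` and letting first `n` tend to infinity and then `ε` to zero bounds the rates.
-/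

open MeasureTheory ProbabilityTheory

/-! ### Causal shears and product densities -/

/-- Adding to each coordinate a function of the earlier coordinates preserves an invariant product
measure: in time order it is a composition of fibrewise translations. -/
theorem measurePreserving_add_causal {E : Type*} [AddGroup E] [MeasurableSpace E]
    [MeasurableAdd₂ E] (μ : Measure E) [SigmaFinite μ] [μ.IsAddRightInvariant] {n : ℕ}
    (u : Fin n → (Fin n → E) → E) (hu : ∀ t, Measurable (u t))
    (hc : ∀ t z z', (∀ s < t, z s = z' s) → u t z = u t z') :
    MeasurePreserving (fun z t => z t + u t z)
      (Measure.pi fun _ : Fin n => μ) (Measure.pi fun _ : Fin n => μ) := by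
  induction n with
  | zero =>
    convert MeasurePreserving.id (Measure.pi fun _ : Fin 0 => μ) using 1
  | succ n ih =>
    let e := MeasurableEquiv.piFinSuccAbove (fun _ : Fin (n + 1) => E) (Fin.last n)
    have he : MeasurePreserving e (Measure.pi fun _ => μ) (μ.prod (Measure.pi fun _ => μ)) :=
      measurePreserving_piFinSuccAbove (fun _ : Fin (n + 1) => μ) (Fin.last n)
    have hsnoc : Measurable (fun z : Fin n → E => (Fin.snoc z 0 : Fin (n + 1) → E)) := by
      refine measurable_pi_iff.2 fun i => ?_
      refine Fin.lastCases ?_ (fun i => ?_) i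
      · simp
      · simpa using measurable_pi_apply i
    have hu' : ∀ t, Measurable fun z : Fin n → E => u t (Fin.snoc z 0) :=
      fun t => (hu t).comp hsnoc
    have IH := ih (fun t z => u t.castSucc (Fin.snoc z 0)) (fun t => hu' _) (by
      intro t z z' h
      refine hc _ _ _ fun s hs => ?_
      obtain ⟨s, rfl⟩ := Fin.exists_castSucc_eq.2 (Fin.ne_last_of_lt hs)
      simpa using h s (by simpa using hs))
    have key := IH.skew_product (μc := μ) (μd := μ)
      (g := fun z x => x + u (Fin.last n) (Fin.snoc z 0))
      (measurable_snd.add ((hu' _).comp measurable_fst))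
      (Filter.Eventually.of_forall fun z => map_add_right_eq_self μ _)
    have hsw : MeasurePreserving Prod.swap (μ.prod (Measure.pi fun _ : Fin n => μ))
      ((Measure.pi fun _ : Fin n => μ).prod μ) := Measure.measurePreserving_swap
    have hsw' : MeasurePreserving Prod.swap ((Measure.pi fun _ : Fin n => μ).prod μ)
      (μ.prod (Measure.pi fun _ : Fin n => μ)) := Measure.measurePreserving_swap
    convert (he.symm e).comp (hsw'.comp (key.comp (hsw.comp he))) using 1
    have hz : ∀ (z : Fin (n + 1) → E) (t : Fin (n + 1)),
        u t z = u t (Fin.snoc (fun s => z s.castSucc) 0) := by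
      intro z t
      refine hc _ _ _ fun s hs => ?_
      obtain ⟨s, rfl⟩ := Fin.exists_castSucc_eq.2 (Fin.ne_last_of_lt hs)
      simp
    funext z t
    simp only [Function.comp_apply, e, MeasurableEquiv.piFinSuccAbove_symm_apply]
    refine Fin.lastCases ?_ (fun i => ?_) t
    · simp [MeasurableEquiv.piFinSuccAbove, Fin.init_def, ← hz]
    · simp [MeasurableEquiv.piFinSuccAbove, Fin.init_def, ← hz]

theorem lintegral_fin_prod_eq_prod {n : ℕ} {E : Fin n → Type*} [∀ i, MeasurableSpace (E i)]
    (μ : ∀ i, Measure (E i)) [∀ i, SigmaFinite (μ i)] (f : ∀ i, E i → ℝ≥0∞)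
    (hf : ∀ i, Measurable (f i)) :
    ∫⁻ x, ∏ i, f i (x i) ∂(Measure.pi μ) = ∏ i, ∫⁻ x, f i x ∂(μ i) := by
  induction n with
  | zero => simp
  | succ n ih =>
    rw [← ((measurePreserving_piFinSuccAbove μ 0).symm).lintegral_comp_emb
      (MeasurableEquiv.measurableEmbedding _)]
    simp only [Fin.prod_univ_succ]
    rw [← ih (fun i => μ i.succ) (fun i => f i.succ) (fun i => hf _)]
    have := lintegral_prod_mul (μ := μ 0) (ν := Measure.pi fun i : Fin n => μ i.succ)
      (f := f 0) (g := fun x => ∏ i, f i.succ (x i)) (hf 0).aemeasurable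
      (Finset.measurable_prod _ fun i _ => (hf _).comp (measurable_pi_apply i)).aemeasurable
    rw [← this]
    rfl

theorem pi_withDensity_fin {n : ℕ} {E : Fin n → Type*} [∀ i, MeasurableSpace (E i)]
    (μ : ∀ i, Measure (E i)) [∀ i, SigmaFinite (μ i)] (f : ∀ i, E i → ℝ≥0∞)
    (hf : ∀ i, Measurable (f i)) [∀ i, SigmaFinite ((μ i).withDensity (f i))] :
    Measure.pi (fun i => (μ i).withDensity (f i)) =
      (Measure.pi μ).withDensity (fun x => ∏ i, f i (x i)) := by
  refine Measure.pi_eq fun s hs => ?_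
  rw [withDensity_apply _ (MeasurableSet.univ_pi hs),
    ← lintegral_indicator (MeasurableSet.univ_pi hs)]
  have : (fun x => (Set.univ.pi s).indicator (fun x => ∏ i, f i (x i)) x) =
      fun x => ∏ i, (s i).indicator (f i) (x i) := by
    funext x
    by_cases h : x ∈ Set.univ.pi s
    · rw [Set.indicator_of_mem h]
      exact Finset.prod_congr rfl fun i _ => (Set.indicator_of_mem (h i trivial) _).symm
    · rw [Set.indicator_of_notMem h]
      simp only [Set.mem_pi, Set.mem_univ, true_imp_iff, not_forall] at h
      obtain ⟨i, hi⟩ := h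
      exact (Finset.prod_eq_zero (Finset.mem_univ i) (Set.indicator_of_notMem hi _)).symm
  rw [this, lintegral_fin_prod_eq_prod μ _ fun i => (hf i).indicator (hs i)]
  refine Finset.prod_congr rfl fun i _ => ?_
  rw [lintegral_indicator (hs i), withDensity_apply _ (hs i)]

theorem pi_pi_gaussianReal {n m : ℕ} (v : Fin m → ℝ≥0) (hv : ∀ j, v j ≠ 0) :
    Measure.pi (fun _ : Fin n => Measure.pi fun j => gaussianReal 0 (v j)) =
      (volume : Measure (Fin n → Fin m → ℝ)).withDensity
        (fun z => ∏ t, ∏ j, gaussianPDF 0 (v j) (z t j)) := by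
  have h1 : Measure.pi (fun j => gaussianReal 0 (v j)) =
      (Measure.pi fun _ : Fin m => (volume : Measure ℝ)).withDensity
        (fun x => ∏ j, gaussianPDF 0 (v j) (x j)) := by
    have : ∀ j, SigmaFinite ((volume : Measure ℝ).withDensity (gaussianPDF 0 (v j))) := by
      intro j
      rw [← gaussianReal_of_var_ne_zero 0 (hv j)]
      infer_instance
    rw [← pi_withDensity_fin _ _ fun j => measurable_gaussianPDF _ _]
    congr 1
    funext j
    exact gaussianReal_of_var_ne_zero 0 (hv j)
  have : ∀ _ : Fin n, SigmaFinite ((Measure.pi fun _ : Fin m => (volume : Measure ℝ)).withDensity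
      (fun x => ∏ j, gaussianPDF 0 (v j) (x j))) := by
    intro _
    rw [← h1]
    infer_instance
  rw [h1]
  exact @pi_withDensity_fin n (fun _ => Fin m → ℝ) _ (fun _ => Measure.pi fun _ => volume) _
    (fun _ x => ∏ j, gaussianPDF 0 (v j) (x j))
    (fun _ => Finset.measurable_prod _ fun j _ =>
      (measurable_gaussianPDF _ _).comp (measurable_pi_apply j)) this

/-! ### Silencing one side of a cut -/

namespace MWRC

theorem output_add {L : ℕ} (x x' z z' : Fin (L + 1) → ℝ) (j : Fin (L + 1)) :
    output (x + x') (z + z') j = output x z j + output x' z' j := by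
  refine Fin.cases ?_ (fun i => ?_) j
  · simp only [output, Fin.cons_zero, Pi.add_apply, Finset.sum_add_distrib]
    ring
  · simp only [output, Fin.cons_succ, Pi.add_apply]
    ring

theorem output_zero_left {L : ℕ} (z : Fin (L + 1) → ℝ) : output 0 z = z := by
  funext j
  refine Fin.cases ?_ (fun i => ?_) j <;> simp [output]

theorem measurable_output {L : ℕ} :
    Measurable fun p : (Fin (L + 1) → ℝ) × (Fin (L + 1) → ℝ) => output p.1 p.2 := by
  refine measurable_pi_iff.2 fun j => ?_
  refine Fin.cases ?_ (fun i => ?_) j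
  · simp only [output, Fin.cons_zero]
    fun_prop
  · simp only [output, Fin.cons_succ]
    fun_prop

namespace BlockCode

variable {L n : ℕ} {M : Fin L → ℕ}

/-- The code in which every node of `S` transmits `0` at all times, the other nodes and all
decoders being kept. -/
def silence (c : BlockCode L n M) (S : Finset (Fin (L + 1))) : BlockCode L n M where
  relayEnc t y := if 0 ∈ S then 0 else c.relayEnc t y
  userEnc i t m y := if i.succ ∈ S then 0 else c.userEnc i t m y
  dec := c.dec
  measurable_relayEnc t := by
    split_ifs
    exacts [measurable_const, c.measurable_relayEnc t]
  measurable_userEnc i t m := by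
    split_ifs
    exacts [measurable_const, c.measurable_userEnc i t m]
  measurable_dec := c.measurable_dec

/-- The part of the channel output at node `j` outside `S` that is caused by the inputs of the
nodes in `S`; it is set to `0` at the nodes in `S`. -/
def cutSignal (c : BlockCode L n M) (S : Finset (Fin (L + 1))) (w : ∀ i, Fin (M i))
    (z : Fin n → Fin (L + 1) → ℝ) (t : Fin n) (j : Fin (L + 1)) : ℝ :=
  if j ∈ S then 0 else output (fun k => if k ∈ S then c.transmitted w z t k else 0) 0 j

theorem history_succ (c : BlockCode L n M) (w : ∀ i, Fin (M i)) (z : Fin n → Fin (L + 1) → ℝ)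
    (t : ℕ) (h : t + 1 ≤ n) :
    c.history w z (t + 1) h =
      Fin.snoc (α := fun _ => Fin (L + 1) → ℝ) (c.history w z t (Nat.le_of_succ_le h))
        (output (c.transmitted w z ⟨t, h⟩) (z ⟨t, h⟩)) := rfl

theorem history_congr (c : BlockCode L n M) (w : ∀ i, Fin (M i))
    {z z' : Fin n → Fin (L + 1) → ℝ} {t : ℕ} (h : t ≤ n)
    (hz : ∀ s : Fin n, (s : ℕ) < t → z s = z' s) :
    c.history w z t h = c.history w z' t h := by
  induction t with
  | zero => rfl
  | succ t ih =>
    have IH := ih (Nat.le_of_succ_le h) fun s hs => hz s (Nat.lt_succ_of_lt hs)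
    rw [history_succ, history_succ, hz ⟨t, h⟩ (Nat.lt_succ_self t)]
    simp only [transmitted, IH]

theorem transmitted_congr (c : BlockCode L n M) (w : ∀ i, Fin (M i))
    {z z' : Fin n → Fin (L + 1) → ℝ} {t : Fin n} (hz : ∀ s < t, z s = z' s) :
    c.transmitted w z t = c.transmitted w z' t := by
  simp only [transmitted]
  rw [c.history_congr w t.isLt.le fun s hs => hz s hs]

theorem measurable_input (c : BlockCode L n M) (w : ∀ i, Fin (M i)) (t : Fin n) :
    Measurable (c.input w t) := by
  refine measurable_pi_iff.2 fun j => ?_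
  refine Fin.cases ?_ (fun i => ?_) j
  · simp only [input, Fin.cons_zero]
    exact (c.measurable_relayEnc t).comp (by fun_prop)
  · simp only [input, Fin.cons_succ]
    exact (c.measurable_userEnc i t (w i)).comp (by fun_prop)

theorem measurable_history (c : BlockCode L n M) (w : ∀ i, Fin (M i)) {t : ℕ} (h : t ≤ n) :
    Measurable fun z => c.history w z t h := by
  induction t with
  | zero => exact measurable_pi_iff.2 fun s => s.elim0
  | succ t ih =>
    have IH := ih (Nat.le_of_succ_le h)
    refine measurable_pi_iff.2 fun s => ?_
    simp only [history_succ]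
    refine Fin.lastCases ?_ (fun s => ?_) s
    · simp only [Fin.snoc_last]
      exact measurable_output.comp
        (((c.measurable_input w ⟨t, h⟩).comp IH).prodMk (measurable_pi_apply _))
    · simp only [Fin.snoc_castSucc]
      exact (measurable_pi_apply s).comp IH

theorem measurable_transmitted (c : BlockCode L n M) (w : ∀ i, Fin (M i)) (t : Fin n) :
    Measurable fun z => c.transmitted w z t :=
  (c.measurable_input w t).comp (c.measurable_history w t.isLt.le)

theorem measurable_received (c : BlockCode L n M) (w : ∀ i, Fin (M i)) :
    Measurable fun z => c.received w z :=
  c.measurable_history w le_rfl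

theorem measurable_cutSignal (c : BlockCode L n M) (S : Finset (Fin (L + 1)))
    (w : ∀ i, Fin (M i)) (t : Fin n) : Measurable fun z => c.cutSignal S w z t := by
  have hx : Measurable fun z k => if k ∈ S then c.transmitted w z t k else 0 := by
    refine measurable_pi_iff.2 fun k => ?_
    split_ifs
    · exact (measurable_pi_apply k).comp (c.measurable_transmitted w t)
    · exact measurable_const
  have hy := measurable_output.comp (hx.prodMk (measurable_const (a := (0 : Fin (L + 1) → ℝ))))
  refine measurable_pi_iff.2 fun j => ?_
  simp only [cutSignal]
  split_ifs
  · exact measurable_const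
  · exact (measurable_pi_apply j).comp hy

theorem cutSignal_congr (c : BlockCode L n M) (S : Finset (Fin (L + 1))) (w : ∀ i, Fin (M i))
    {z z' : Fin n → Fin (L + 1) → ℝ} {t : Fin n} (hz : ∀ s < t, z s = z' s) :
    c.cutSignal S w z t = c.cutSignal S w z' t := by
  funext j
  simp only [cutSignal, c.transmitted_congr w hz]

theorem silence_input (c : BlockCode L n M) (S : Finset (Fin (L + 1))) (w : ∀ i, Fin (M i))
    (t : Fin n) (y : Fin t → Fin (L + 1) → ℝ) (k : Fin (L + 1)) :
    (c.silence S).input w t y k = if k ∈ S then 0 else c.input w t y k := by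
  refine Fin.cases ?_ (fun i => ?_) k <;> rfl

theorem input_congr (c : BlockCode L n M) (w : ∀ i, Fin (M i)) (t : Fin n)
    {y y' : Fin t → Fin (L + 1) → ℝ} {k : Fin (L + 1)} (h : ∀ s, y s k = y' s k) :
    c.input w t y k = c.input w t y' k := by
  revert h
  refine Fin.cases (fun h => ?_) (fun i h => ?_) k <;> simp [input, h]

/-- Outside `S`, silencing the nodes in `S` cannot be noticed when the signal they would have
caused is added to the noise instead. -/
theorem history_silence (c : BlockCode L n M) (S : Finset (Fin (L + 1))) (w : ∀ i, Fin (M i))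
    (z : Fin n → Fin (L + 1) → ℝ) {j : Fin (L + 1)} (hj : j ∉ S) {t : ℕ} (h : t ≤ n)
    (s : Fin t) :
    (c.silence S).history w (fun t => z t + c.cutSignal S w z t) t h s j =
      c.history w z t h s j := by
  induction t generalizing j with
  | zero => exact s.elim0
  | succ t ih =>
    rw [history_succ, history_succ]
    refine Fin.lastCases ?_ (fun s => ?_) s
    · simp only [Fin.snoc_last]
      set z' : Fin n → Fin (L + 1) → ℝ := fun t => z t + c.cutSignal S w z t
      have h1 : c.transmitted w z ⟨t, h⟩ = (c.silence S).transmitted w z' ⟨t, h⟩ +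
          fun k => if k ∈ S then c.transmitted w z ⟨t, h⟩ k else 0 := by
        funext k
        simp only [Pi.add_apply]
        rw [transmitted, transmitted, silence_input]
        split_ifs with hk
        · rw [zero_add]
        · rw [add_zero]
          exact c.input_congr w _ fun s => (ih hk (Nat.le_of_succ_le h) s).symm
      have h2 := output_add ((c.silence S).transmitted w z' ⟨t, h⟩)
        (fun k => if k ∈ S then c.transmitted w z ⟨t, h⟩ k else 0) (z ⟨t, h⟩) 0 j
      rw [← h1, add_zero] at h2
      have h3 := output_add ((c.silence S).transmitted w z' ⟨t, h⟩) 0 (z ⟨t, h⟩)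
        (c.cutSignal S w z ⟨t, h⟩) j
      rw [add_zero, output_zero_left] at h3
      rw [h2]
      refine h3.trans ?_
      rw [cutSignal, if_neg hj]
    · simp only [Fin.snoc_castSucc]
      exact ih hj _ s

theorem silence_input_congr (c : BlockCode L n M) (S : Finset (Fin (L + 1)))
    {w w' : ∀ i, Fin (M i)} (hw : ∀ i : Fin L, i.succ ∉ S → w i = w' i) (t : Fin n) :
    (c.silence S).input w t = (c.silence S).input w' t := by
  funext y k
  rw [silence_input, silence_input]
  split_ifs with hk
  · rfl
  · revert hk
    refine Fin.cases (fun _ => rfl) (fun i hi => ?_) k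
    simp [input, hw i hi]

theorem silence_history_congr (c : BlockCode L n M) (S : Finset (Fin (L + 1)))
    {w w' : ∀ i, Fin (M i)} (hw : ∀ i : Fin L, i.succ ∉ S → w i = w' i)
    (z : Fin n → Fin (L + 1) → ℝ) {t : ℕ} (h : t ≤ n) :
    (c.silence S).history w z t h = (c.silence S).history w' z t h := by
  induction t with
  | zero => rfl
  | succ t ih =>
    rw [history_succ, history_succ, ih (Nat.le_of_succ_le h)]
    simp only [transmitted]
    rw [ih, c.silence_input_congr S hw]

end BlockCode

end MWRC

/-! ### Change of measure for causally shifted Gaussian noise -/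

/-- White Gaussian noise: independent centred Gaussian variables, that with index `(t, j)` having
variance `v j`. -/
noncomputable def gaussianNoise (n : ℕ) {m : ℕ} (v : Fin m → ℝ≥0) :
    Measure (Fin n → Fin m → ℝ) :=
  Measure.pi fun _ : Fin n => Measure.pi fun j => gaussianReal 0 (v j)

instance {n m : ℕ} (v : Fin m → ℝ≥0) : IsProbabilityMeasure (gaussianNoise n v) := by
  unfold gaussianNoise
  infer_instance

/-- The information density: the logarithm of the ratio of the density of standard Gaussian noise
at `z` to the density of `gaussianNoise n v` at `y`. -/
noncomputable def infoDensity {n m : ℕ} (v : Fin m → ℝ≥0) (z y : Fin n → Fin m → ℝ) : ℝ :=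
  ∑ t, ∑ j, (Real.log (v j) / 2 - z t j ^ 2 / 2 + y t j ^ 2 / (2 * v j))

theorem measurable_infoDensity {n m : ℕ} (v : Fin m → ℝ≥0) :
    Measurable fun p : (Fin n → Fin m → ℝ) × (Fin n → Fin m → ℝ) => infoDensity v p.1 p.2 := by
  unfold infoDensity
  fun_prop

theorem exp_mul_gaussianPDF {v : ℝ≥0} (hv : v ≠ 0) (x y : ℝ) :
    ENNReal.ofReal (Real.exp (-(Real.log v / 2 - x ^ 2 / 2 + y ^ 2 / (2 * v)))) *
      gaussianPDF 0 1 x = gaussianPDF 0 v y := by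
  have hv' : (0 : ℝ) < v := by positivity
  rw [gaussianPDF, gaussianPDF, ← ENNReal.ofReal_mul (Real.exp_pos _).le]
  congr 1
  simp only [gaussianPDFReal, sub_zero, NNReal.coe_one, mul_one]
  rw [Real.sqrt_mul (by positivity) (v : ℝ), mul_inv, mul_left_comm, ← Real.exp_add, mul_assoc]
  congr 1
  have : (√(v : ℝ))⁻¹ = Real.exp (-(Real.log v / 2)) := by
    rw [Real.exp_neg, ← Real.log_sqrt hv'.le, Real.exp_log (Real.sqrt_pos.2 hv')]
  rw [this, ← Real.exp_add]
  congr 1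
  ring

theorem exp_infoDensity_mul_prod {n m : ℕ} {v : Fin m → ℝ≥0} (hv : ∀ j, v j ≠ 0)
    (z y : Fin n → Fin m → ℝ) :
    (∏ t, ∏ j, gaussianPDF 0 1 (z t j)) * ENNReal.ofReal (Real.exp (-infoDensity v z y)) =
      ∏ t, ∏ j, gaussianPDF 0 (v j) (y t j) := by
  simp only [infoDensity, ← Finset.sum_neg_distrib, Real.exp_sum]
  rw [ENNReal.ofReal_prod_of_nonneg fun _ _ => Finset.prod_nonneg fun _ _ => (Real.exp_pos _).le,
    ← Finset.prod_mul_distrib]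
  refine Finset.prod_congr rfl fun t _ => ?_
  rw [ENNReal.ofReal_prod_of_nonneg fun _ _ => (Real.exp_pos _).le, ← Finset.prod_mul_distrib]
  refine Finset.prod_congr rfl fun j _ => ?_
  rw [mul_comm, exp_mul_gaussianPDF (hv j)]

/-- Weighting by the likelihood ratio turns causally shifted standard noise into `gaussianNoise`
with variances `v`. -/
theorem lintegral_exp_neg_infoDensity {n m : ℕ} {v : Fin m → ℝ≥0} (hv : ∀ j, v j ≠ 0)
    (u : Fin n → (Fin n → Fin m → ℝ) → Fin m → ℝ) (hu : ∀ t, Measurable (u t))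
    (hc : ∀ t z z', (∀ s < t, z s = z' s) → u t z = u t z')
    {g : (Fin n → Fin m → ℝ) → ℝ≥0∞} (hg : Measurable g) :
    ∫⁻ z, ENNReal.ofReal (Real.exp (-infoDensity v z (fun t => z t + u t z))) *
      g (fun t => z t + u t z) ∂(gaussianNoise n fun _ : Fin m => 1) =
      ∫⁻ z, g z ∂(gaussianNoise n v) := by
  have hT : MeasurePreserving (fun z t => z t + u t z)
      (volume : Measure (Fin n → Fin m → ℝ)) volume := measurePreserving_add_causal volume u hu hc
  have hm : ∀ v : Fin m → ℝ≥0, Measurable fun z : Fin n → Fin m → ℝ =>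
      ∏ t, ∏ j, gaussianPDF 0 (v j) (z t j) := fun v =>
    Finset.measurable_prod _ fun t _ => Finset.measurable_prod _ fun j _ =>
      (measurable_gaussianPDF _ _).comp (by fun_prop)
  have hI : Measurable fun z : Fin n → Fin m → ℝ =>
      ENNReal.ofReal (Real.exp (-infoDensity v z (fun t => z t + u t z))) :=
    ENNReal.measurable_ofReal.comp (Real.measurable_exp.comp
      ((measurable_infoDensity v).comp (measurable_id.prodMk hT.measurable)).neg)
  rw [gaussianNoise, gaussianNoise, pi_pi_gaussianReal _ hv,
    pi_pi_gaussianReal _ fun _ => one_ne_zero,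
    lintegral_withDensity_eq_lintegral_mul _ (hm _) hg, ← hT.lintegral_comp ((hm _).mul hg)]
  refine (lintegral_withDensity_eq_lintegral_mul volume (hm fun _ => 1)
    (hI.mul (hg.comp hT.measurable))).trans ?_
  refine lintegral_congr fun z => ?_
  simp only [Pi.mul_apply, Function.comp_apply]
  rw [← mul_assoc, exp_infoDensity_mul_prod hv]

theorem lintegral_sq_gaussianReal (v : ℝ≥0) :
    ∫⁻ x, ENNReal.ofReal (x ^ 2) ∂(gaussianReal 0 v) = v := by
  have h := variance_id_gaussianReal (μ := 0) (v := v)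
  have hL := memLp_id_gaussianReal (μ := 0) (v := v) 2
  rw [variance_of_integral_eq_zero (by fun_prop) (by simp)] at h
  have hL' : Integrable (fun x : ℝ => x ^ 2) (gaussianReal 0 v) := hL.integrable_sq
  rw [← ofReal_integral_eq_lintegral_ofReal hL'
    (Filter.Eventually.of_forall fun x => sq_nonneg x)]
  simp only [id] at h
  rw [h, ENNReal.ofReal_coe_nnreal]

theorem lintegral_sq_gaussianNoise {n m : ℕ} (v : Fin m → ℝ≥0) (t : Fin n) (j : Fin m) :
    ∫⁻ z, ENNReal.ofReal (z t j ^ 2) ∂(gaussianNoise n v) = v j := by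
  have h1 : MeasurePreserving (fun z : Fin n → Fin m → ℝ => z t) (gaussianNoise n v)
      (Measure.pi fun j => gaussianReal 0 (v j)) := measurePreserving_eval _ t
  have h2 : MeasurePreserving (fun x : Fin m → ℝ => x j)
      (Measure.pi fun j => gaussianReal 0 (v j)) (gaussianReal 0 (v j)) :=
    measurePreserving_eval _ j
  rw [← lintegral_sq_gaussianReal]
  exact (h2.comp h1).lintegral_comp (f := fun x => ENNReal.ofReal (x ^ 2)) (by fun_prop)

/-- Flipping the sign of the noise at one time preserves its law. -/
theorem measurePreserving_neg_at {n m : ℕ} (v : Fin m → ℝ≥0) (t : Fin n) :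
    MeasurePreserving (fun (z : Fin n → Fin m → ℝ) s => if s = t then -z s else z s)
      (gaussianNoise n v) (gaussianNoise n v) := by
  have h1 : MeasurePreserving (fun x : Fin m → ℝ => -x)
      (Measure.pi fun j => gaussianReal 0 (v j)) (Measure.pi fun j => gaussianReal 0 (v j)) :=
    measurePreserving_pi (fun j => gaussianReal 0 (v j)) (fun j => gaussianReal 0 (v j))
      (f := fun _ x => -x) fun j => ⟨measurable_neg, by rw [gaussianReal_map_neg, neg_zero]⟩
  refine measurePreserving_pi (fun _ : Fin n => Measure.pi fun j => gaussianReal 0 (v j))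
    (fun _ => Measure.pi fun j => gaussianReal 0 (v j))
    (f := fun s x => if s = t then -x else x) fun s => ?_
  by_cases h : s = t
  · simpa [h] using h1
  · simpa only [h, if_false] using! MeasurePreserving.id _

/-- Noise and a causal signal are uncorrelated, so their powers add. The cross term vanishes
because flipping the sign of the present noise does not change the signal; in this form no
integrability is needed. -/
theorem lintegral_sq_add_causal {n m : ℕ} (v : Fin m → ℝ≥0) (t : Fin n) (j : Fin m)
    {u : (Fin n → Fin m → ℝ) → ℝ} (hu : Measurable u)
    (hc : ∀ z z', (∀ s < t, z s = z' s) → u z = u z') :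
    ∫⁻ z, ENNReal.ofReal ((z t j + u z) ^ 2) ∂(gaussianNoise n v) =
      v j + ∫⁻ z, ENNReal.ofReal (u z ^ 2) ∂(gaussianNoise n v) := by
  have hm : Measurable fun z : Fin n → Fin m → ℝ => ENNReal.ofReal ((z t j + u z) ^ 2) := by
    fun_prop
  have hflip := (measurePreserving_neg_at v t).lintegral_comp hm
  have hu' : ∀ z : Fin n → Fin m → ℝ, u (fun s => if s = t then -z s else z s) = u z := by
    intro z
    refine hc _ _ fun s hs => ?_
    simp [hs.ne]
  simp only [hu', if_true, Pi.neg_apply] at hflip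
  have hsum : ∫⁻ z, ENNReal.ofReal ((-z t j + u z) ^ 2) ∂(gaussianNoise n v) +
      ∫⁻ z, ENNReal.ofReal ((z t j + u z) ^ 2) ∂(gaussianNoise n v) =
      2 * (v j + ∫⁻ z, ENNReal.ofReal (u z ^ 2) ∂(gaussianNoise n v)) := by
    rw [← lintegral_sq_gaussianNoise v t j, ← lintegral_add_right _ hm,
      ← lintegral_add_right _ (by fun_prop), ← lintegral_const_mul _ (by fun_prop)]
    refine lintegral_congr fun z => ?_
    rw [← ENNReal.ofReal_add (sq_nonneg _) (sq_nonneg _),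
      ← ENNReal.ofReal_add (sq_nonneg _) (sq_nonneg _), ← ENNReal.ofReal_ofNat,
      ← ENNReal.ofReal_mul (by norm_num)]
    congr 1
    ring
  rw [hflip, ← two_mul] at hsum
  exact (ENNReal.mul_right_inj two_ne_zero ENNReal.ofNat_ne_top).1 hsum

/-! ### Fano's inequality by change of measure -/

/-- If the likelihood ratio `exp (-f)` gives mass at most `1 / K` to the event `A`, then
`P(A) log K` is at most the divergence `∫ f` up to `log 2`. This is the Donsker-Varadhan bound
for the function `log K` on `A` and `0` elsewhere; it plays the role of Fano's inequality and of
the data processing inequality together. -/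
theorem measureReal_mul_log_le {Ω : Type*} [MeasurableSpace Ω] {μ : Measure Ω}
    [IsProbabilityMeasure μ] {f : Ω → ℝ} (hf : Integrable f μ) {A : Set Ω}
    (hA : MeasurableSet A) {K : ℝ} (hK : 0 < K)
    (h1 : ∫⁻ ω, ENNReal.ofReal (Real.exp (-f ω)) ∂μ ≤ 1)
    (h2 : ∫⁻ ω in A, ENNReal.ofReal (Real.exp (-f ω)) ∂μ ≤ ENNReal.ofReal K⁻¹) :
    μ.real A * Real.log K ≤ ∫ ω, f ω ∂μ + Real.log 2 := by
  have hm : AEStronglyMeasurable (fun ω => Real.exp (-f ω)) μ :=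
    Real.continuous_exp.comp_aestronglyMeasurable hf.aestronglyMeasurable.neg
  have hint : Integrable (fun ω => Real.exp (-f ω)) μ :=
    (lintegral_ofReal_ne_top_iff_integrable hm
      (Filter.Eventually.of_forall fun _ => (Real.exp_pos _).le)).1
      (h1.trans_lt ENNReal.one_lt_top).ne
  have i1 : ∫ ω, Real.exp (-f ω) ∂μ ≤ 1 := by
    rw [integral_eq_lintegral_of_nonneg_ae
      (Filter.Eventually.of_forall fun _ => (Real.exp_pos _).le) hm]
    exact ENNReal.toReal_le_of_le_ofReal zero_le_one (by simpa using h1)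
  have i2 : ∫ ω in A, Real.exp (-f ω) ∂μ ≤ K⁻¹ := by
    rw [integral_eq_lintegral_of_nonneg_ae
      (Filter.Eventually.of_forall fun _ => (Real.exp_pos _).le) hm.restrict]
    exact ENNReal.toReal_le_of_le_ofReal (by positivity) h2
  -- `log x ≤ x - 1` at half the likelihood ratio, which is weighted by `K` on `A`; with that
  -- weight its mass is at most `2`, hence the factor `1 / 2`
  have hpt : ∀ ω, A.indicator (fun _ => Real.log K) ω - f ω - Real.log 2 ≤
      (Real.exp (-f ω) + K * A.indicator (fun ω => Real.exp (-f ω)) ω) / 2 - 1 := by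
    intro ω
    have he := Real.exp_pos (-f ω)
    by_cases h : ω ∈ A
    · simp only [Set.indicator_of_mem h]
      have := Real.log_le_sub_one_of_pos (x := K * Real.exp (-f ω) / 2) (by positivity)
      rw [Real.log_div (by positivity) (by norm_num), Real.log_mul hK.ne' he.ne',
        Real.log_exp] at this
      linarith
    · simp only [Set.indicator_of_notMem h]
      have := Real.log_le_sub_one_of_pos (x := Real.exp (-f ω) / 2) (by positivity)
      rw [Real.log_div he.ne' (by norm_num), Real.log_exp] at this
      linarith
  have hi1 : Integrable (A.indicator fun _ : Ω => Real.log K) μ :=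
    (integrable_const _).indicator hA
  have hi2 : Integrable (A.indicator fun ω => Real.exp (-f ω)) μ := hint.indicator hA
  have hi3 : Integrable (fun ω => A.indicator (fun _ => Real.log K) ω - f ω) μ := hi1.sub hf
  have hi4 : Integrable
      (fun ω => Real.exp (-f ω) + K * A.indicator (fun ω => Real.exp (-f ω)) ω) μ :=
    hint.add (hi2.const_mul K)
  have := integral_mono (hi3.sub (integrable_const (Real.log 2)))
    ((hi4.div_const 2).sub (integrable_const 1)) hpt
  simp only [Pi.sub_apply] at this
  rw [integral_sub hi3 (integrable_const _), integral_sub hi1 hf,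
    integral_sub (hi4.div_const 2) (integrable_const _), integral_div,
    integral_add hint (hi2.const_mul K), integral_const_mul,
    integral_indicator hA, integral_indicator hA] at this
  simp only [integral_const, smul_eq_mul, probReal_univ, one_mul, measureReal_restrict_apply_univ]
    at this
  have h3 : K * ∫ ω in A, Real.exp (-f ω) ∂μ ≤ 1 := by
    calc _ ≤ K * K⁻¹ := by gcongr
      _ = 1 := mul_inv_cancel₀ hK.ne'
  linarith

/-! ### The cut-set bound -/

namespace MWRC

/-- A set of uniform messages whose members are determined by their coordinates outside `T` has
probability at most `∏ i ∈ T, 1 / M i`. -/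
theorem pi_uniformOn_le {L : ℕ} {M : Fin L → ℕ} (hM : ∀ i, M i ≠ 0) (T : Finset (Fin L))
    (B : Set (∀ i, Fin (M i)))
    (hB : ∀ w ∈ B, ∀ w' ∈ B, (∀ i ∉ T, w i = w' i) → w = w') :
    Measure.pi (fun i => uniformOn (Set.univ : Set (Fin (M i)))) B ≤
      ∏ i ∈ T, (M i : ℝ≥0∞)⁻¹ := by
  classical
  have hne : ∀ i, Nonempty (Fin (M i)) := fun i => ⟨⟨0, Nat.pos_of_ne_zero (hM i)⟩⟩
  have hsing : ∀ w : ∀ i, Fin (M i),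
      Measure.pi (fun i => uniformOn (Set.univ : Set (Fin (M i)))) {w} =
        ∏ i, (M i : ℝ≥0∞)⁻¹ := by
    intro w
    rw [Measure.pi_singleton]
    refine Finset.prod_congr rfl fun i _ => ?_
    rw [uniformOn_univ, Measure.count_singleton]
    simp
  have hcard : B.toFinset.card ≤ ∏ i ∈ Tᶜ, M i := by
    have : B.toFinset.card ≤ Fintype.card (∀ i : {i // i ∈ Tᶜ}, Fin (M i)) := by
      refine Finset.card_le_card_of_injOn (fun w i => w i) (fun _ _ => Finset.mem_univ _) ?_
      intro w hw w' hw' h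
      refine hB w (by simpa using hw) w' (by simpa using hw') fun i hi => ?_
      exact congrFun h ⟨i, by simpa using hi⟩
    rw [Fintype.card_pi] at this
    simp only [Fintype.card_fin] at this
    rwa [Finset.prod_coe_sort Tᶜ fun i => M i] at this
  calc Measure.pi (fun i => uniformOn (Set.univ : Set (Fin (M i)))) B
      = ∑ w ∈ B.toFinset, Measure.pi (fun i => uniformOn (Set.univ : Set (Fin (M i)))) {w} := by
        rw [sum_measure_singleton, Set.coe_toFinset]
    _ = B.toFinset.card * ∏ i, (M i : ℝ≥0∞)⁻¹ := by simp [hsing]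
    _ ≤ (∏ i ∈ Tᶜ, M i : ℕ) * ∏ i, (M i : ℝ≥0∞)⁻¹ := by gcongr
    _ = ∏ i ∈ T, (M i : ℝ≥0∞)⁻¹ := by
        rw [← Finset.prod_mul_prod_compl T, mul_left_comm, Nat.cast_prod,
          ← Finset.prod_mul_distrib]
        rw [Finset.prod_eq_one (s := Tᶜ), mul_one]
        intro i _
        exact ENNReal.mul_inv_cancel (by simpa using hM i) (by simp)

theorem lintegral_law {L n : ℕ} (ch : MWRC L) {M : Fin L → ℕ} (hM : ∀ i, M i ≠ 0)
    {f : (∀ i, Fin (M i)) × (Fin n → Fin (L + 1) → ℝ) → ℝ≥0∞}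
    (hf : ∀ w, Measurable fun z => f (w, z)) :
    ∫⁻ ω, f ω ∂(ch.law n M) = ∫⁻ w, ∫⁻ z, f (w, z) ∂(gaussianNoise n ch.noiseVar)
      ∂(Measure.pi fun i => uniformOn (Set.univ : Set (Fin (M i)))) := by
  have hne : ∀ i, Nonempty (Fin (M i)) := fun i => ⟨⟨0, Nat.pos_of_ne_zero (hM i)⟩⟩
  exact lintegral_prod _ (measurable_from_prod_countable_right hf).aemeasurable

theorem isProbabilityMeasure_law {L : ℕ} (ch : MWRC L) (n : ℕ) {M : Fin L → ℕ}
    (hM : ∀ i, M i ≠ 0) : IsProbabilityMeasure (ch.law n M) := by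
  have hne : ∀ i, Nonempty (Fin (M i)) := fun i => ⟨⟨0, Nat.pos_of_ne_zero (hM i)⟩⟩
  unfold law
  infer_instance

namespace BlockCode

variable {L n : ℕ} {M : Fin L → ℕ}

/-- The event that user `i` decodes the messages of all users in `S` correctly. -/
def correctEvent (c : BlockCode L n M) (S : Finset (Fin (L + 1))) (i : Fin L) :
    Set ((∀ i, Fin (M i)) × (Fin n → Fin (L + 1) → ℝ)) :=
  {ω | ∀ j : {j : Fin L // j ≠ i}, j.1.succ ∈ S →
    c.dec i (fun t => c.received ω.1 ω.2 t i.succ) (ω.1 i) j = ω.1 j}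

theorem measurableSet_correctEvent_section (c : BlockCode L n M) (S : Finset (Fin (L + 1)))
    (i : Fin L) (w : ∀ i, Fin (M i)) : MeasurableSet {z | (w, z) ∈ c.correctEvent S i} := by
  have hm : Measurable fun z => c.dec i (fun t => c.received w z t i.succ) (w i) := by
    refine (c.measurable_dec i (w i)).comp (measurable_pi_iff.2 fun t => ?_)
    exact (measurable_pi_apply i.succ).comp
      ((measurable_pi_apply t).comp (c.measurable_received w))
  change MeasurableSet {z | ∀ j : {j : Fin L // j ≠ i}, j.1.succ ∈ S →
    c.dec i (fun t => c.received w z t i.succ) (w i) j = w j}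
  simp only [Set.ofPred_forall]
  refine MeasurableSet.iInter fun (j : {j : Fin L // j ≠ i}) =>
    MeasurableSet.iInter fun (_ : j.1.succ ∈ S) => ?_
  exact ((measurable_pi_apply j).comp hm) (measurableSet_singleton (w j))

theorem measurableSet_correctEvent (c : BlockCode L n M) (S : Finset (Fin (L + 1))) (i : Fin L) :
    MeasurableSet (c.correctEvent S i) := by
  have : Measurable fun ω : (∀ i, Fin (M i)) × (Fin n → Fin (L + 1) → ℝ) =>
      ω ∈ c.correctEvent S i :=
    measurable_from_prod_countable_right fun w => measurable_mem.2
      (c.measurableSet_correctEvent_section S i w)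
  exact measurableSet_setOfPred.2 this

/-- A user on the receiving side of the cut decodes equally well when the nodes in `S` are
silenced and their signal is added to the noise instead. -/
theorem mem_correctEvent_silence (c : BlockCode L n M) (S : Finset (Fin (L + 1))) {i : Fin L}
    (hi : i.succ ∉ S) (w : ∀ i, Fin (M i)) (z : Fin n → Fin (L + 1) → ℝ) :
    (w, fun t => z t + c.cutSignal S w z t) ∈ (c.silence S).correctEvent S i ↔
      (w, z) ∈ c.correctEvent S i := by
  have : ∀ t, (c.silence S).received w (fun t => z t + c.cutSignal S w z t) t i.succ =
      c.received w z t i.succ := fun t => c.history_silence S w z hi le_rfl t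
  simp only [correctEvent, Set.mem_ofPred_eq, this]
  rfl

/-- When the nodes in `S` are silenced, nothing outside `S` depends on their messages, so these
can only be guessed. -/
theorem measure_correctEvent_silence_le (c : BlockCode L n M) (hM : ∀ i, M i ≠ 0)
    (S : Finset (Fin (L + 1))) {i : Fin L} (hi : i.succ ∉ S)
    (ν : Measure (Fin n → Fin (L + 1) → ℝ))
    [IsProbabilityMeasure ν] :
    ((Measure.pi fun i => uniformOn (Set.univ : Set (Fin (M i)))).prod ν)
      ((c.silence S).correctEvent S i) ≤
      ∏ i with i.succ ∈ S, (M i : ℝ≥0∞)⁻¹ := by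
  have hne : ∀ i, Nonempty (Fin (M i)) := fun i => ⟨⟨0, Nat.pos_of_ne_zero (hM i)⟩⟩
  rw [Measure.prod_apply_symm ((c.silence S).measurableSet_correctEvent S i)]
  refine (lintegral_mono fun z => pi_uniformOn_le hM {i | i.succ ∈ S} _ ?_).trans (by simp)
  intro w hw w' hw' h
  simp only [Finset.mem_filter, Finset.mem_univ, true_and] at h
  funext j
  by_cases hj : j.succ ∈ S
  · have hji : j ≠ i := by
      rintro rfl
      exact hi hj
    have h1 := hw ⟨j, hji⟩ hj
    have h2 := hw' ⟨j, hji⟩ hj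
    simp only [received] at h1 h2
    rw [c.silence_history_congr S h, h i hi] at h1
    exact h1.symm.trans h2
  · exact h j hj

/-- The information density of the cut `S`: the log-likelihood ratio of the noise against the
noise with the signal of `S` added, when the latter is modelled as Gaussian with variances `v`. -/
noncomputable def cutDensity (c : BlockCode L n M) (S : Finset (Fin (L + 1)))
    (v : Fin (L + 1) → ℝ≥0) (ω : (∀ i, Fin (M i)) × (Fin n → Fin (L + 1) → ℝ)) : ℝ :=
  infoDensity v ω.2 (fun t => ω.2 t + c.cutSignal S ω.1 ω.2 t)

theorem measurable_add_cutSignal (c : BlockCode L n M) (S : Finset (Fin (L + 1)))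
    (w : ∀ i, Fin (M i)) :
    Measurable fun (z : Fin n → Fin (L + 1) → ℝ) t => z t + c.cutSignal S w z t :=
  measurable_pi_iff.2 fun t => (measurable_pi_apply t).add (c.measurable_cutSignal S w t)

theorem measurable_cutDensity (c : BlockCode L n M) (S : Finset (Fin (L + 1)))
    (v : Fin (L + 1) → ℝ≥0) : Measurable (c.cutDensity S v) := by
  refine measurable_from_prod_countable_right fun w => ?_
  have h : Measurable fun z : Fin n → Fin (L + 1) → ℝ =>
      (z, fun t => z t + c.cutSignal S w z t) :=
    measurable_id.prodMk (c.measurable_add_cutSignal S w)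
  have h' := (measurable_infoDensity v).comp h
  exact h'

/-- Reweighted by `exp (-cutDensity)`, the messages and the noise shifted by the signal of `S`
become independent uniform messages and Gaussian noise with variances `v`. -/
theorem lintegral_exp_neg_cutDensity (c : BlockCode L n M) {ch : MWRC L}
    (hch : ∀ j, ch.noiseVar j = 1) (hM : ∀ i, M i ≠ 0) (S : Finset (Fin (L + 1)))
    {v : Fin (L + 1) → ℝ≥0} (hv : ∀ j, v j ≠ 0)
    {B : Set ((∀ i, Fin (M i)) × (Fin n → Fin (L + 1) → ℝ))} (hB : MeasurableSet B) :
    ∫⁻ ω in {ω | (ω.1, fun t => ω.2 t + c.cutSignal S ω.1 ω.2 t) ∈ B},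
      ENNReal.ofReal (Real.exp (-c.cutDensity S v ω)) ∂(ch.law n M) =
    ((Measure.pi fun i => uniformOn (Set.univ : Set (Fin (M i)))).prod (gaussianNoise n v)) B := by
  have hne : ∀ i, Nonempty (Fin (M i)) := fun i => ⟨⟨0, Nat.pos_of_ne_zero (hM i)⟩⟩
  have hT := c.measurable_add_cutSignal S
  have hTB : MeasurableSet {ω : (∀ i, Fin (M i)) × (Fin n → Fin (L + 1) → ℝ) |
      (ω.1, fun t => ω.2 t + c.cutSignal S ω.1 ω.2 t) ∈ B} := by
    have : Measurable fun ω : (∀ i, Fin (M i)) × (Fin n → Fin (L + 1) → ℝ) =>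
        (ω.1, fun t => ω.2 t + c.cutSignal S ω.1 ω.2 t) :=
      measurable_from_prod_countable_right fun w => measurable_const.prodMk (hT w)
    exact this hB
  have hch' : ch.noiseVar = fun _ => 1 := funext hch
  have hI : ∀ w, Measurable fun z => ENNReal.ofReal (Real.exp (-c.cutDensity S v (w, z))) :=
    fun w => ENNReal.measurable_ofReal.comp (Real.measurable_exp.comp
      ((c.measurable_cutDensity S v).comp measurable_prodMk_left).neg)
  rw [← lintegral_indicator hTB, lintegral_law ch hM, Measure.prod_apply hB]
  · refine lintegral_congr fun w => ?_
    have hBw : MeasurableSet (Prod.mk w ⁻¹' B) := measurable_prodMk_left hB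
    rw [← lintegral_indicator_one hBw, ← lintegral_exp_neg_infoDensity hv
      (fun t z => c.cutSignal S w z t) (c.measurable_cutSignal S w)
      (fun t z z' h => c.cutSignal_congr S w h) (measurable_one.indicator hBw), hch']
    refine lintegral_congr fun z => ?_
    by_cases h : (w, fun t => z t + c.cutSignal S w z t) ∈ B
    · rw [Set.indicator_of_mem (by exact h), Set.indicator_of_mem (by exact h)]
      simp [cutDensity]
    · rw [Set.indicator_of_notMem (by exact h), Set.indicator_of_notMem (by exact h), mul_zero]
  · intro w
    have hs : MeasurableSet {z : Fin n → Fin (L + 1) → ℝ |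
        (w, fun t => z t + c.cutSignal S w z t) ∈ B} := by
      exact (measurable_prodMk_left (x := w)).comp (hT w) hB
    exact (hI w).indicator hs

theorem lintegral_sq_add_cutSignal (c : BlockCode L n M) {ch : MWRC L} (hM : ∀ i, M i ≠ 0)
    (S : Finset (Fin (L + 1))) (t : Fin n) (j : Fin (L + 1)) :
    ∫⁻ ω, ENNReal.ofReal ((ω.2 t + c.cutSignal S ω.1 ω.2 t) j ^ 2) ∂(ch.law n M) =
      ch.noiseVar j + ∫⁻ ω, ENNReal.ofReal (c.cutSignal S ω.1 ω.2 t j ^ 2) ∂(ch.law n M) := by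
  have hne : ∀ i, Nonempty (Fin (M i)) := fun i => ⟨⟨0, Nat.pos_of_ne_zero (hM i)⟩⟩
  have h' : ∀ w, Measurable fun z : Fin n → Fin (L + 1) → ℝ => c.cutSignal S w z t j := fun w =>
    (measurable_pi_apply j).comp (c.measurable_cutSignal S w t)
  rw [lintegral_law ch hM, lintegral_law ch hM]
  · simp only [Pi.add_apply]
    rw [lintegral_congr fun w => lintegral_sq_add_causal ch.noiseVar t j (h' w)
      fun z z' h => by rw [c.cutSignal_congr S w h],
      lintegral_add_left measurable_const, lintegral_const]
    simp
  · exact fun w => ENNReal.measurable_ofReal.comp ((h' w).pow_const 2)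
  · intro w
    have := h' w
    simp only [Pi.add_apply]
    fun_prop

theorem lintegral_sq_noise {ch : MWRC L} (hM : ∀ i, M i ≠ 0) (t : Fin n) (j : Fin (L + 1)) :
    ∫⁻ ω, ENNReal.ofReal (ω.2 t j ^ 2) ∂(ch.law n M) = ch.noiseVar j := by
  have hne : ∀ i, Nonempty (Fin (M i)) := fun i => ⟨⟨0, Nat.pos_of_ne_zero (hM i)⟩⟩
  rw [lintegral_law ch hM fun w => by fun_prop]
  simp [lintegral_sq_gaussianNoise]

end BlockCode
end MWRC

theorem integral_sq_of_lintegral {Ω : Type*} [MeasurableSpace Ω] {μ : Measure Ω} {X : Ω → ℝ}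
    (hX : Measurable X) (h : ∫⁻ ω, ENNReal.ofReal (X ω ^ 2) ∂μ ≠ ∞) :
    Integrable (fun ω => X ω ^ 2) μ ∧
      ∫ ω, X ω ^ 2 ∂μ = (∫⁻ ω, ENNReal.ofReal (X ω ^ 2) ∂μ).toReal := by
  have hn : 0 ≤ᵐ[μ] fun ω => X ω ^ 2 := Filter.Eventually.of_forall fun ω => sq_nonneg _
  have hm : AEStronglyMeasurable (fun ω => X ω ^ 2) μ := (hX.pow_const 2).aestronglyMeasurable
  exact ⟨(lintegral_ofReal_ne_top_iff_integrable hm hn).1 h,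
    integral_eq_lintegral_of_nonneg_ae hn hm⟩

namespace MWRC

namespace BlockCode

variable {L n : ℕ} {M : Fin L → ℕ}

/-- If the signal of `S` has average power at most `σ j` at node `j`, then the mean of the
information density is at most that of Gaussian channels with signal-to-noise ratios `σ j`. -/
theorem integral_cutDensity_le (c : BlockCode L n M) {ch : MWRC L}
    (hch : ∀ j, ch.noiseVar j = 1) (hM : ∀ i, M i ≠ 0) (S : Finset (Fin (L + 1)))
    (σ : Fin (L + 1) → ℝ≥0)
    (hσ : ∀ j, ∑ t, ∫⁻ ω, ENNReal.ofReal (c.cutSignal S ω.1 ω.2 t j ^ 2) ∂(ch.law n M) ≤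
      n * σ j) :
    Integrable (c.cutDensity S fun j => 1 + σ j) (ch.law n M) ∧
      ∫ ω, c.cutDensity S (fun j => 1 + σ j) ω ∂(ch.law n M) ≤
        n * ∑ j, Real.log (1 + σ j) / 2 := by
  have hprob := isProbabilityMeasure_law ch n hM
  have hZ : ∀ (t : Fin n) j, Integrable (fun ω => ω.2 t j ^ 2) (ch.law n M) ∧
      ∫ ω, ω.2 t j ^ 2 ∂(ch.law n M) = 1 := by
    intro t j
    have h1 := lintegral_sq_noise (ch := ch) hM t j
    have h2 := integral_sq_of_lintegral (μ := ch.law n M) (X := fun ω => ω.2 t j)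
      (by fun_prop) (by rw [h1]; exact ENNReal.coe_ne_top)
    rw [h1, hch] at h2
    simpa using h2
  set p : Fin n → Fin (L + 1) → ℝ≥0∞ := fun t j =>
    ∫⁻ ω, ENNReal.ofReal (c.cutSignal S ω.1 ω.2 t j ^ 2) ∂(ch.law n M) with hp
  have hptop : ∀ t j, p t j ≠ ∞ := by
    intro t j
    refine ne_top_of_le_ne_top ?_ ((Finset.single_le_sum (f := fun t => p t j)
      (fun _ _ => zero_le) (Finset.mem_univ t)).trans (hσ j))
    exact ENNReal.mul_ne_top (ENNReal.natCast_ne_top n) ENNReal.coe_ne_top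
  have hpsum : ∀ j, ∑ t, (p t j).toReal ≤ n * σ j := by
    intro j
    rw [← ENNReal.toReal_sum fun t _ => hptop t j]
    refine ENNReal.toReal_le_of_le_ofReal (by positivity) ((hσ j).trans_eq ?_)
    rw [ENNReal.ofReal_mul (by positivity), ENNReal.ofReal_natCast, ENNReal.ofReal_coe_nnreal]
  have hY : ∀ (t : Fin n) j,
      Integrable (fun ω => (ω.2 t + c.cutSignal S ω.1 ω.2 t) j ^ 2) (ch.law n M) ∧
      ∫ ω, (ω.2 t + c.cutSignal S ω.1 ω.2 t) j ^ 2 ∂(ch.law n M) = 1 + (p t j).toReal := by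
    intro t j
    have h1 := c.lintegral_sq_add_cutSignal (ch := ch) hM S t j
    have hm : Measurable fun ω : (∀ i, Fin (M i)) × (Fin n → Fin (L + 1) → ℝ) =>
        (ω.2 t + c.cutSignal S ω.1 ω.2 t) j :=
      measurable_from_prod_countable_right fun w => (measurable_pi_apply j).comp
        ((measurable_pi_apply t).comp (c.measurable_add_cutSignal S w))
    have h2 := integral_sq_of_lintegral (μ := ch.law n M) hm (by
      rw [h1]; exact ENNReal.add_ne_top.2 ⟨ENNReal.coe_ne_top, hptop t j⟩)
    rw [h1, hch, ENNReal.toReal_add ENNReal.coe_ne_top (hptop t j)] at h2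
    simpa using h2
  have hterm : ∀ (t : Fin n) j, Integrable (fun ω => Real.log ((1 + σ j : ℝ≥0) : ℝ) / 2 -
      ω.2 t j ^ 2 / 2 + (ω.2 t + c.cutSignal S ω.1 ω.2 t) j ^ 2 / (2 * ((1 + σ j : ℝ≥0) : ℝ)))
      (ch.law n M) := fun t j =>
    ((integrable_const _).sub ((hZ t j).1.div_const 2)).add ((hY t j).1.div_const _)
  have hval : ∀ (t : Fin n) j, ∫ ω, (Real.log ((1 + σ j : ℝ≥0) : ℝ) / 2 -
      ω.2 t j ^ 2 / 2 + (ω.2 t + c.cutSignal S ω.1 ω.2 t) j ^ 2 / (2 * ((1 + σ j : ℝ≥0) : ℝ)))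
      ∂(ch.law n M) = Real.log (1 + σ j) / 2 - 1 / 2 +
        (1 + (p t j).toReal) / (2 * (1 + σ j)) := by
    intro t j
    have hd : Integrable (fun ω => Real.log ((1 + σ j : ℝ≥0) : ℝ) / 2 - ω.2 t j ^ 2 / 2)
        (ch.law n M) := (integrable_const _).sub ((hZ t j).1.div_const 2)
    rw [integral_add hd ((hY t j).1.div_const _),
      integral_sub (integrable_const _) ((hZ t j).1.div_const 2),
      integral_const, integral_div, integral_div,
      (hZ t j).2, (hY t j).2]
    simp
  refine ⟨?_, ?_⟩
  · unfold cutDensity infoDensity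
    exact integrable_finsetSum _ fun t _ => integrable_finsetSum _ fun j _ => hterm t j
  · unfold cutDensity infoDensity
    rw [integral_finsetSum _ fun t _ => integrable_finsetSum _ fun j _ => hterm t j]
    rw [Finset.sum_congr rfl fun t _ => integral_finsetSum _ fun j _ => hterm t j]
    simp only [hval]
    rw [Finset.sum_comm, Finset.mul_sum]
    refine Finset.sum_le_sum fun j _ => ?_
    have hs : (0 : ℝ) < 1 + σ j := by positivity
    rw [Finset.sum_add_distrib, ← Finset.sum_div, Finset.sum_add_distrib]
    simp only [Finset.sum_const, Finset.card_univ, Fintype.card_fin, nsmul_eq_mul, mul_one]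
    have h1 : (n + ∑ t, (p t j).toReal) / (2 * (1 + σ j)) ≤ n / 2 := by
      rw [div_le_div_iff₀ (by positivity) (by norm_num)]
      nlinarith [hpsum j]
    linarith

/-- The cut-set bound for one code: the messages of the users in `S`, decoded by a user outside
`S`, carry at most the information that the signal of `S` can convey across the cut. -/
theorem cutset_bound (c : BlockCode L n M) {ch : MWRC L} (hch : ∀ j, ch.noiseVar j = 1)
    (hM : ∀ i, M i ≠ 0) (S : Finset (Fin (L + 1))) {i : Fin L} (hi : i.succ ∉ S)
    (σ : Fin (L + 1) → ℝ≥0)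
    (hσ : ∀ j, ∑ t, ∫⁻ ω, ENNReal.ofReal (c.cutSignal S ω.1 ω.2 t j ^ 2) ∂(ch.law n M) ≤
      n * σ j) :
    (ch.law n M).real (c.correctEvent S i) * ∑ i with i.succ ∈ S, Real.log (M i) ≤
      n * ∑ j, Real.log (1 + σ j) / 2 + Real.log 2 := by
  have hprob := isProbabilityMeasure_law ch n hM
  have hne : ∀ i, Nonempty (Fin (M i)) := fun i => ⟨⟨0, Nat.pos_of_ne_zero (hM i)⟩⟩
  have hM' : ∀ i, (0 : ℝ) < M i := fun i => by exact_mod_cast Nat.pos_of_ne_zero (hM i)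
  obtain ⟨hint, hle⟩ := c.integral_cutDensity_le hch hM S σ hσ
  have hv : ∀ j, 1 + σ j ≠ 0 := fun j => by positivity
  rw [← Real.log_prod fun i _ => (hM' i).ne']
  refine (measureReal_mul_log_le hint (c.measurableSet_correctEvent S i)
    (Finset.prod_pos fun i _ => hM' i) ?_ ?_).trans (by linarith)
  · have h := c.lintegral_exp_neg_cutDensity hch hM S hv MeasurableSet.univ
    simp only [Set.mem_univ, Set.ofPred_true, Measure.restrict_univ, measure_univ] at h
    exact h.le
  · have h := c.lintegral_exp_neg_cutDensity hch hM S hv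
      ((c.silence S).measurableSet_correctEvent S i)
    have hset : {ω : (∀ i, Fin (M i)) × (Fin n → Fin (L + 1) → ℝ) |
        (ω.1, fun t => ω.2 t + c.cutSignal S ω.1 ω.2 t) ∈ (c.silence S).correctEvent S i} =
        c.correctEvent S i := Set.ext fun ω => c.mem_correctEvent_silence S hi ω.1 ω.2
    rw [hset] at h
    rw [h]
    refine (c.measure_correctEvent_silence_le hM S hi _).trans_eq ?_
    rw [← Finset.prod_inv_distrib, ENNReal.ofReal_prod_of_nonneg fun i _ => (inv_pos.2 (hM' i)).le]
    refine Finset.prod_congr rfl fun i _ => ?_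
    rw [ENNReal.ofReal_inv_of_pos (hM' i), ENNReal.ofReal_natCast]

theorem one_sub_errorProb_le (c : BlockCode L n M) {ch : MWRC L} (hM : ∀ i, M i ≠ 0)
    (S : Finset (Fin (L + 1))) (i : Fin L) {ε : ℝ} (hε : c.errorProb ch < ENNReal.ofReal ε) :
    1 - ε ≤ (ch.law n M).real (c.correctEvent S i) := by
  have hprob := isProbabilityMeasure_law ch n hM
  have hsub : (c.correctEvent S i)ᶜ ⊆ c.errorEvent := by
    intro ω hω
    by_contra h
    refine hω fun j _ => ?_
    by_contra hj
    exact h ⟨i, j, hj⟩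
  have h1 : (ch.law n M).real (c.correctEvent S i)ᶜ ≤ ε := by
    have hε0 : 0 < ε := by
      by_contra h
      rw [ENNReal.ofReal_of_nonpos (not_lt.1 h)] at hε
      exact not_lt_zero hε
    exact ENNReal.toReal_le_of_le_ofReal hε0.le ((measure_mono hsub).trans hε.le)
  rw [probReal_compl_eq_one_sub (c.measurableSet_correctEvent S i)] at h1
  linarith

theorem SatisfiesPower.sum_le {c : BlockCode L n M} {ch : MWRC L} (h : c.SatisfiesPower ch)
    (hn : n ≠ 0) (j : Fin (L + 1)) :
    ∑ t, ∫⁻ ω, ENNReal.ofReal (c.transmitted ω.1 ω.2 t j ^ 2) ∂(ch.law n M) ≤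
      n * ENNReal.ofReal (ch.power j) := by
  have := h j
  rwa [ENNReal.div_le_iff_le_mul (Or.inl (by simpa using hn)) (Or.inl (by simp)), mul_comm]
    at this

/-! ### The two cuts -/

theorem cutSignal_uplink (c : BlockCode L n M) (T : Finset (Fin L)) (w : ∀ i, Fin (M i))
    (z : Fin n → Fin (L + 1) → ℝ) (t : Fin n) (j : Fin (L + 1)) :
    c.cutSignal (T.map (Fin.succEmb L)) w z t j =
      if j = 0 then ∑ i ∈ T, c.transmitted w z t i.succ else 0 := by
  unfold cutSignal
  refine Fin.cases ?_ (fun i => ?_) j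
  · simp [output, Finset.sum_ite_mem]
  · simp [output]

theorem cutSignal_downlink (c : BlockCode L n M) (i : Fin L) (w : ∀ i, Fin (M i))
    (z : Fin n → Fin (L + 1) → ℝ) (t : Fin n) (j : Fin (L + 1)) :
    c.cutSignal (Finset.univ.erase i.succ) w z t j =
      if j = i.succ then c.transmitted w z t 0 else 0 := by
  by_cases h : j = i.succ
  · subst h
    simp [cutSignal, output, (Fin.succ_ne_zero i).symm]
  · simp [cutSignal, h]

theorem sum_log_ite_eq {m : ℕ} (k : Fin m) {x : ℝ} (hx : 0 ≤ x) :
    ∑ j, Real.log (1 + ((if j = k then x.toNNReal else 0 : ℝ≥0) : ℝ)) / 2 =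
      Real.log (1 + x) / 2 := by
  rw [Finset.sum_eq_single k (by intro j _ hj; simp [hj]) (by simp), if_pos rfl,
    Real.coe_toNNReal _ hx]

/-- The cut between a set `T` of users and the rest: the relay hears the sum of the inputs of
`T`, whose power is at most `|T| ^ 2 * P` even if the inputs are fully correlated. -/
theorem uplink_bound (c : BlockCode L n M) {P P₀ : ℝ} (hP : 0 ≤ P) (hn : n ≠ 0)
    (hM : ∀ i, M i ≠ 0) (hc : c.SatisfiesPower (symmetric L P P₀)) (T : Finset (Fin L))
    {i : Fin L} (hi : i ∉ T) {ε : ℝ} (hε : c.errorProb (symmetric L P P₀) < ENNReal.ofReal ε) :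
    (1 - ε) * ∑ i ∈ T, Real.log (M i) ≤
      n * (Real.log (1 + (T.card : ℝ) ^ 2 * P) / 2) + Real.log 2 := by
  have hσ : ∀ j, ∑ t, ∫⁻ ω, ENNReal.ofReal
      (c.cutSignal (T.map (Fin.succEmb L)) ω.1 ω.2 t j ^ 2) ∂((symmetric L P P₀).law n M) ≤
      n * ((if j = 0 then Real.toNNReal ((T.card : ℝ) ^ 2 * P) else 0 : ℝ≥0) : ℝ≥0∞) := by
    intro j
    by_cases hj : j = 0
    · simp only [cutSignal_uplink, hj, if_true]
      calc ∑ t, ∫⁻ ω, ENNReal.ofReal ((∑ i ∈ T, c.transmitted ω.1 ω.2 t i.succ) ^ 2)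
            ∂((symmetric L P P₀).law n M)
          ≤ ∑ t, ∑ i ∈ T, T.card * ∫⁻ ω, ENNReal.ofReal (c.transmitted ω.1 ω.2 t i.succ ^ 2)
            ∂((symmetric L P P₀).law n M) := by
            refine Finset.sum_le_sum fun t _ => ?_
            have hm : ∀ i : Fin L, Measurable
                fun ω : (∀ i, Fin (M i)) × (Fin n → Fin (L + 1) → ℝ) =>
                  ENNReal.ofReal (c.transmitted ω.1 ω.2 t i.succ ^ 2) := fun i =>
              measurable_from_prod_countable_right fun w => ENNReal.measurable_ofReal.comp
                (((measurable_pi_apply i.succ).comp (c.measurable_transmitted w t)).pow_const 2)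
            simp only [← lintegral_const_mul _ (hm _)]
            rw [← lintegral_finsetSum _ fun i _ => (hm i).const_mul _]
            refine lintegral_mono fun ω => ?_
            rw [← Finset.mul_sum, ← ENNReal.ofReal_sum_of_nonneg fun _ _ => sq_nonneg _,
              ← ENNReal.ofReal_natCast, ← ENNReal.ofReal_mul (by positivity)]
            exact ENNReal.ofReal_le_ofReal sq_sum_le_card_mul_sum_sq
        _ = ∑ i ∈ T, T.card * ∑ t, ∫⁻ ω, ENNReal.ofReal (c.transmitted ω.1 ω.2 t i.succ ^ 2)
            ∂((symmetric L P P₀).law n M) := by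
            rw [Finset.sum_comm]
            simp only [Finset.mul_sum]
        _ ≤ ∑ i ∈ T, T.card * (n * ENNReal.ofReal P) := by
            gcongr with i
            exact hc.sum_le hn i.succ
        _ = n * ((Real.toNNReal ((T.card : ℝ) ^ 2 * P) : ℝ≥0) : ℝ≥0∞) := by
            rw [Finset.sum_const, nsmul_eq_mul]
            change _ = n * ENNReal.ofReal _
            rw [ENNReal.ofReal_mul (by positivity), ENNReal.ofReal_pow (by positivity),
              ENNReal.ofReal_natCast]
            ring
    · simp [cutSignal_uplink, hj]
  have h := c.cutset_bound (fun _ => rfl) hM (T.map (Fin.succEmb L)) (i := i) (by simpa using hi)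
    (fun j => if j = 0 then Real.toNNReal ((T.card : ℝ) ^ 2 * P) else 0) hσ
  have hfil : (Finset.univ.filter fun i : Fin L => i.succ ∈ T.map (Fin.succEmb L)) = T := by
    ext i
    simp
  rw [hfil, sum_log_ite_eq _ (by positivity)] at h
  refine le_trans ?_ h
  gcongr
  exact c.one_sub_errorProb_le hM _ i hε

/-- The cut around user `i`: all it learns about the other messages comes from the relay. -/
theorem downlink_bound (c : BlockCode L n M) {P P₀ : ℝ} (hP₀ : 0 ≤ P₀) (hn : n ≠ 0)
    (hM : ∀ i, M i ≠ 0) (hc : c.SatisfiesPower (symmetric L P P₀)) (i : Fin L) {ε : ℝ}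
    (hε : c.errorProb (symmetric L P P₀) < ENNReal.ofReal ε) :
    (1 - ε) * ∑ j ∈ Finset.univ.erase i, Real.log (M j) ≤
      n * (Real.log (1 + P₀) / 2) + Real.log 2 := by
  have hσ : ∀ j, ∑ t, ∫⁻ ω, ENNReal.ofReal
      (c.cutSignal (Finset.univ.erase i.succ) ω.1 ω.2 t j ^ 2) ∂((symmetric L P P₀).law n M) ≤
      n * ((if j = i.succ then Real.toNNReal P₀ else 0 : ℝ≥0) : ℝ≥0∞) := by
    intro j
    by_cases hj : j = i.succ
    · simp only [cutSignal_downlink, hj, if_true]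
      exact hc.sum_le hn 0
    · simp [cutSignal_downlink, hj]
  have h := c.cutset_bound (fun _ => rfl) hM (Finset.univ.erase i.succ) (i := i) (by simp)
    (fun j => if j = i.succ then Real.toNNReal P₀ else 0) hσ
  have hfil : (Finset.univ.filter fun j : Fin L => j.succ ∈ Finset.univ.erase i.succ) =
      Finset.univ.erase i := by
    ext j
    simp
  rw [hfil, sum_log_ite_eq _ hP₀] at h
  refine le_trans ?_ h
  gcongr
  exact c.one_sub_errorProb_le hM _ i hε

end BlockCode

/-! ### From codes to rates -/

/-- A bound on `k` times the logarithm of the number of messages that is linear in the block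
length, and loses a factor `1 - ε` with error probability `ε`, bounds the achievable rates. -/
theorem IsAchievable.mul_le {L : ℕ} {ch : MWRC L} {R : ℝ} (hR : ch.IsAchievable fun _ => R)
    {k : ℕ} {C : ℝ}
    (h : ∀ n ≠ 0, ∀ m ≠ 0, ∀ (c : BlockCode L n fun _ => m), c.SatisfiesPower ch → ∀ ε : ℝ,
      c.errorProb ch < ENNReal.ofReal ε → (1 - ε) * (k * Real.log m) ≤ n * C + Real.log 2)
    (hL : L ≠ 0) : k * (R * Real.log 2) ≤ C := by
  have hR0 : 0 ≤ R := hR.1 ⟨0, Nat.pos_of_ne_zero hL⟩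
  have hε : ∀ ε ∈ Set.Ioo (0 : ℝ) 1, (1 - ε) * (k * (R * Real.log 2)) ≤ C := by
    rintro ε ⟨hε0, hε1⟩
    have hlim : Filter.Tendsto
        (fun n : ℕ => C + (Real.log 2 + (1 - ε) * (k * Real.log 2)) / (n : ℝ))
        Filter.atTop (nhds C) := by
      simpa using (tendsto_const_nhds (x := C)).add (tendsto_const_div_atTop_nhds_zero_nat _)
    refine ge_of_tendsto hlim ?_
    filter_upwards [hR.2 ε hε0, Filter.eventually_ne_atTop 0] with n ⟨c, hc, he⟩ hn
    have hx : (1 : ℝ) ≤ 2 ^ ((n : ℝ) * R) := Real.one_le_rpow (by norm_num) (by positivity)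
    have hm : ⌊(2 : ℝ) ^ ((n : ℝ) * R)⌋₊ ≠ 0 := (Nat.floor_pos.2 hx).ne'
    have hb := h n hn _ hm c hc ε he
    -- the floor costs at most one bit, since `x / 2 ≤ ⌊x⌋` for `1 ≤ x`
    have hfl : (n * R - 1) * Real.log 2 ≤ Real.log ⌊(2 : ℝ) ^ ((n : ℝ) * R)⌋₊ := by
      have h1 : (2 : ℝ) ^ ((n : ℝ) * R) / 2 ≤ ⌊(2 : ℝ) ^ ((n : ℝ) * R)⌋₊ := by
        have h2 := Nat.lt_floor_add_one ((2 : ℝ) ^ ((n : ℝ) * R))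
        have h3 : (1 : ℝ) ≤ ⌊(2 : ℝ) ^ ((n : ℝ) * R)⌋₊ := by
          exact_mod_cast Nat.one_le_iff_ne_zero.2 hm
        linarith
      have h4 := Real.log_le_log (by positivity) h1
      rw [Real.log_div (by positivity) (by norm_num), Real.log_rpow (by norm_num)] at h4
      linarith
    have hn' : (0 : ℝ) < n := by exact_mod_cast Nat.pos_of_ne_zero hn
    have h5 : (1 - ε) * (k * ((n * R - 1) * Real.log 2)) ≤ n * C + Real.log 2 := by
      refine le_trans ?_ hb
      have : 0 ≤ 1 - ε := by linarith
      gcongr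
    rw [← sub_le_iff_le_add', le_div_iff₀ hn']
    linarith
  have hlim : Filter.Tendsto (fun ε : ℝ => (1 - ε) * (k * (R * Real.log 2)))
      (nhdsWithin 0 (Set.Ioi 0)) (nhds (k * (R * Real.log 2))) := by
    have : Continuous fun ε : ℝ => (1 - ε) * (k * (R * Real.log 2)) := by fun_prop
    simpa using (this.tendsto 0).mono_left nhdsWithin_le_nhds
  exact le_of_tendsto hlim
    (Filter.mem_of_superset (Ioo_mem_nhdsGT zero_lt_one) hε)

theorem le_div_mul_logb {k R x : ℝ} (hk : 0 < k)
    (h : k * (R * Real.log 2) ≤ Real.log x / 2) : R ≤ 1 / (2 * k) * Real.logb 2 x := by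
  have h2 : 0 < Real.log 2 := Real.log_pos (by norm_num)
  rw [Real.logb, div_mul_div_comm, one_mul, le_div_iff₀ (by positivity)]
  linarith

end MWRC

theorem lemma2 (L : ℕ) (hL : 2 ≤ L) (P P₀ : ℝ) (hP : 0 ≤ P) (hP₀ : 0 ≤ P₀) :
    (MWRC.symmetric L P P₀).equalRateCapacity ≤
      ((min
        ((Finset.Icc 1 (L - 1)).inf' (Finset.nonempty_Icc.mpr (Nat.le_sub_one_of_lt hL))
          (fun ℓ : ℕ => 1 / (2 * (ℓ : ℝ)) * Real.logb 2 (1 + (ℓ : ℝ) ^ 2 * P)))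
        (1 / (2 * ((L : ℝ) - 1)) * Real.logb 2 (1 + P₀)) : ℝ) : EReal) := by
  have hL0 : L ≠ 0 := by lia
  let i₀ : Fin L := ⟨0, by lia⟩
  have hcard : (Finset.univ.erase i₀).card = L - 1 := by
    rw [Finset.card_erase_of_mem (Finset.mem_univ _), Finset.card_univ, Fintype.card_fin]
  refine sSup_le ?_
  rintro _ ⟨R, hR, rfl⟩
  refine EReal.coe_le_coe_iff.2 (le_min (Finset.le_inf' _ _ fun ℓ hℓ => ?_) ?_)
  · obtain ⟨h1, h2⟩ := Finset.mem_Icc.1 hℓ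
    obtain ⟨T, hT, rfl⟩ := Finset.exists_subset_card_eq (s := Finset.univ.erase i₀)
      (h2.trans_eq hcard.symm)
    refine MWRC.le_div_mul_logb (by exact_mod_cast h1) (hR.mul_le (fun n hn m hm c hc ε hε => ?_)
      hL0)
    have := c.uplink_bound hP hn (fun _ => hm) hc T (i := i₀) (fun h => by simpa using hT h) hε
    simpa using this
  · refine MWRC.le_div_mul_logb (sub_pos.2 (by exact_mod_cast hL)) ?_
    have hcast : ((L - 1 : ℕ) : ℝ) = (L : ℝ) - 1 := by
      rw [Nat.cast_sub (by lia), Nat.cast_one]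
    rw [← hcast]
    refine hR.mul_le (fun n hn m hm c hc ε hε => ?_) hL0
    have := c.downlink_bound hP₀ hn (fun _ => hm) hc i₀ hε
    rwa [Finset.sum_const, hcard, nsmul_eq_mul] at this
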